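/- Let $h\ge 0$ be an integer, $m=2h+1$, $q=3^{m}$ and $\alpha=3^{h+1}$. Let $\operatorname{Tr}$ denote the absolute trace from $\mathbb F_q$ to $\mathbb F_3$, let $\chi$ be the (multiplicative) quadratic character of $\mathbb F_q$, and let $\xi_3=e^{2\pi i/3}$. Then for any $\beta,a\in\mathbb F_q^*$, $$\sum_{x\in\mathbb F_q^*}\chi(x)\,\xi_3^{\operatorname{Tr}\left(x^{\alpha+2}+(\beta^{\alpha-1}a^{\alpha}-\beta^{2(\alpha-1)}a^{2\alpha})x\right)}=\pm\sqrt{-q},$$ that is, the sum equals $i\sqrt q$ or $-i\sqrt q$. -/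

import Mathlib

/-! Put b = β^(α-1) a^α and let σ be the α-power map, so that σ² is cubing. As the trace is
Frobenius-invariant, the exponent Tr(x^(α+2) + (b - b²)x) equals Tr(f(x)) with f(x) = σ(x)²x³ +
σ(b)σ(x) - b²x (`balancedTrace_mul_reeTits`). This f is odd, and it is a permutation of F
(`reeTits_injective`). Let S(γ) = ∑ χ(x)ψ(γ f(x)), with ψ the trace character. Since χ is odd too (q
≡ 3 mod 4), S(γ) = (i√3/2) T(γ) for an integer T(γ), which is `charTraceSum`.

Three facts determine T(γ) up to sign for γ ≠ 0. Parseval gives 3 ∑ T(γ)² = 4q(q-1), because f is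
injective. Pairing x with -x gives T(γ) ≡ 2 mod 4. Finally 3^h divides T(γ). Hence |T(γ)| ≥ 2·3^h
for every γ ≠ 0, while the mean square over those γ is exactly (2·3^h)², so equality holds
throughout; γ = 1 is the theorem.

The divisibility is a Stickelberger-type argument. The trace is expanded modulo a power of 3 in
monomials of Teichmüller representatives in the Witt vectors. A monomial survives summation against
χ only if its exponent is (q-1)/2 modulo q-1, whose ternary digits are all 1; counting carries
(`card_digits_le_sum_digits`) shows that such a monomial has a coefficient divisible by 3^h. -/

/-! ### Cyclic ternary digits and carries. -/

/-- The integer with base-three digits `f`, the digit at `i` having weight `3 ^ i`. -/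
def ternaryValue {n : ℕ} (f : ZMod (n + 1) → ℤ) : ℤ := ∑ i, f i * 3 ^ i.val

theorem ternaryValue_add {n : ℕ} (f g : ZMod (n + 1) → ℤ) :
    ternaryValue (f + g) = ternaryValue f + ternaryValue g := by
  simp [ternaryValue, add_mul, Finset.sum_add_distrib]

theorem ternaryValue_sub {n : ℕ} (f g : ZMod (n + 1) → ℤ) :
    ternaryValue (f - g) = ternaryValue f - ternaryValue g := by
  simp [ternaryValue, sub_mul, Finset.sum_sub_distrib]

theorem ternaryValue_smul {n : ℕ} (c : ℤ) (f : ZMod (n + 1) → ℤ) :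
    ternaryValue (c • f) = c * ternaryValue f := by
  simp [ternaryValue, Finset.mul_sum, mul_assoc]

theorem ternaryValue_single {n : ℕ} (a : ZMod (n + 1)) :
    ternaryValue (Pi.single a 1) = 3 ^ a.val := by
  simp [ternaryValue, Pi.single_apply]

theorem three_mul_ternaryValue_shift {n : ℕ} (f : ZMod (n + 1) → ℤ) :
    3 * ternaryValue (fun i => f (i + 1)) = ternaryValue f + (3 ^ (n + 1) - 1) * f 0 := by
  have key : ∀ g : Fin (n + 1) → ℤ, 3 * ∑ i : Fin (n + 1), g (i + 1) * 3 ^ (i : ℕ) =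
      ∑ i : Fin (n + 1), g i * 3 ^ (i : ℕ) + (3 ^ (n + 1) - 1) * g 0 := by
    intro g
    rw [Fin.sum_univ_castSucc, Fin.sum_univ_succ (f := fun i => g i * 3 ^ (i : ℕ))]
    simp only [Fin.coeSucc_eq_succ, Fin.last_add_one, Fin.val_castSucc, Fin.val_last,
      Fin.val_succ, Fin.val_zero, pow_zero, mul_add, Finset.mul_sum]
    have : ∑ i : Fin n, 3 * (g i.succ * 3 ^ (i : ℕ)) = ∑ i : Fin n, g i.succ * 3 ^ ((i : ℕ) + 1) :=
      Finset.sum_congr rfl fun i _ => by ring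
    rw [this]
    ring
  exact key f

theorem two_mul_ternaryValue_one {n : ℕ} :
    2 * ternaryValue (1 : ZMod (n + 1) → ℤ) = 3 ^ (n + 1) - 1 := by
  have := three_mul_ternaryValue_shift (1 : ZMod (n + 1) → ℤ)
  have h1 : (fun i : ZMod (n + 1) => (1 : ZMod (n + 1) → ℤ) (i + 1)) = 1 := rfl
  rw [h1] at this
  simp only [Pi.one_apply] at this
  linarith

theorem ternaryValue_shift_modEq {n : ℕ} (f : ZMod (n + 1) → ℤ) (t : ℕ) :
    ternaryValue (fun i : ZMod (n + 1) => f (i - (t : ZMod (n + 1)))) ≡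
      3 ^ t * ternaryValue f [ZMOD 3 ^ (n + 1) - 1] := by
  induction t with
  | zero => simp
  | succ t ih =>
    have := three_mul_ternaryValue_shift (fun i => f (i - ((t + 1 : ℕ) : ZMod (n + 1))))
    have e : (fun i : ZMod (n + 1) => f (i + 1 - ((t + 1 : ℕ) : ZMod (n + 1)))) =
        fun i => f (i - (t : ZMod (n + 1))) := by
      funext i; congr 1; push_cast; ring
    simp only [e] at this
    have h2 : ternaryValue (fun i => f (i - ((t + 1 : ℕ) : ZMod (n + 1)))) ≡
        3 * ternaryValue (fun i => f (i - (t : ZMod (n + 1)))) [ZMOD 3 ^ (n + 1) - 1] :=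
      Int.modEq_iff_dvd.2 ⟨_, by rw [this, add_sub_cancel_left]⟩
    refine h2.trans ?_
    have h3 := ih.mul_left 3
    rwa [← mul_assoc, ← pow_succ'] at h3

theorem isCoprime_pow_sub_one_three (n : ℕ) : IsCoprime ((3 : ℤ) ^ (n + 1) - 1) 3 :=
  ⟨-1, 3 ^ n, by ring⟩

/-- Carries of a cyclic ternary addition whose value vanishes modulo `3 ^ (n + 1) - 1`. -/
theorem exists_cyclic_carries {n : ℕ} (D : ZMod (n + 1) → ℤ)
    (hD : (3 ^ (n + 1) - 1 : ℤ) ∣ ternaryValue D) :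
    ∃ c : ZMod (n + 1) → ℤ, ∀ i, 3 * c i = D i + c (i - 1) := by
  have hrec : ∀ i, 3 * ternaryValue (fun l => D (l + (i + 1))) =
      ternaryValue (fun l => D (l + i)) + (3 ^ (n + 1) - 1) * D i := by
    intro i
    have := three_mul_ternaryValue_shift (fun l => D (l + i))
    simp only [zero_add] at this
    rw [← this]
    congr 2
    funext l; congr 1; ring
  have hdvd : ∀ t : ℕ, (3 ^ (n + 1) - 1 : ℤ) ∣ ternaryValue (fun l => D (l + (t : ZMod (n + 1)))) := by
    intro t
    induction t with
    | zero => simpa using hD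
    | succ t ih =>
      refine (isCoprime_pow_sub_one_three n).dvd_of_dvd_mul_left ?_
      push_cast
      rw [hrec]
      exact dvd_add ih (dvd_mul_right _ _)
  have hdvd' : ∀ i, (3 ^ (n + 1) - 1 : ℤ) ∣ ternaryValue (fun l => D (l + i)) := by
    intro i
    simpa using hdvd i.val
  choose b hb using hdvd'
  -- The carry out of place `i` is the value of the digit string rotated by `i + 1`, divided by `3 ^
  -- (n + 1) - 1`.
  refine ⟨fun i => b (i + 1), fun i => ?_⟩
  have hne : (3 ^ (n + 1) - 1 : ℤ) ≠ 0 := by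
    have : (1 : ℤ) < 3 ^ (n + 1) := one_lt_pow₀ (by norm_num) (by omega)
    omega
  have := hrec i
  rw [hb, hb] at this
  apply mul_left_cancel₀ hne
  simp only [sub_add_cancel]
  linarith

theorem carries_nonneg {n : ℕ} {c D : ZMod (n + 1) → ℤ} (hD : ∀ i, -1 ≤ D i)
    (hc : ∀ i, 3 * c i = D i + c (i - 1)) (i : ZMod (n + 1)) : 0 ≤ c i := by
  obtain ⟨i₀, h₀⟩ := Finite.exists_min c
  have h1 := hc i₀
  have h2 := h₀ (i₀ - 1)
  have h3 := hD i₀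
  have h4 := h₀ i
  omega

theorem exists_reduced_digits {n : ℕ} (j : ZMod (n + 1) → ℤ) (hj : ∀ i, 0 ≤ j i) :
    ∃ j' : ZMod (n + 1) → ℤ, (∀ i, 0 ≤ j' i ∧ j' i ≤ 2) ∧ ∑ i, j' i ≤ ∑ i, j i ∧
      ternaryValue j' ≡ ternaryValue j [ZMOD 3 ^ (n + 1) - 1] := by
  induction hs : (∑ i, j i).toNat using Nat.strong_induction_on generalizing j with
  | _ N ih =>
    by_cases hle : ∀ i, j i ≤ 2
    · exact ⟨j, fun i => ⟨hj i, hle i⟩, le_rfl, Int.ModEq.refl _⟩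
    push Not at hle
    obtain ⟨a, ha⟩ := hle
    -- Trading 3 at place `a` for 1 at the cyclically next place keeps the residue and lowers the
    -- digit sum by 2.
    set g : ZMod (n + 1) → ℤ := j - (3 : ℤ) • Pi.single a 1 + Pi.single (a + 1) 1 with hg
    have hg0 : ∀ i, 0 ≤ g i := by
      intro i
      have h1 : 0 ≤ (Pi.single (a + 1) 1 : ZMod (n + 1) → ℤ) i := by
        rw [Pi.single_apply]; split_ifs <;> norm_num
      have h2 : 0 ≤ j i - 3 * (Pi.single a 1 : ZMod (n + 1) → ℤ) i := by
        rw [Pi.single_apply]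
        split_ifs with h
        · subst h; omega
        · have := hj i; omega
      simp only [hg, Pi.add_apply, Pi.sub_apply, Pi.smul_apply, smul_eq_mul]
      omega
    have hsum : ∑ i, g i = ∑ i, j i - 2 := by
      simp only [hg, Pi.add_apply, Pi.sub_apply, Pi.smul_apply, smul_eq_mul,
        Finset.sum_add_distrib, Finset.sum_sub_distrib, ← Finset.mul_sum, Finset.sum_pi_single',
        Finset.mem_univ, if_true]
      simp
      ring
    have hpos : 0 ≤ ∑ i, g i := Finset.sum_nonneg fun i _ => hg0 i
    obtain ⟨j', h1, h2, h3⟩ := ih (∑ i, g i).toNat (by omega) g hg0 rfl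
    refine ⟨j', h1, by omega, h3.trans ?_⟩
    rw [hg, ternaryValue_add, ternaryValue_sub, ternaryValue_smul]
    have hs := ternaryValue_shift_modEq (Pi.single a 1 : ZMod (n + 1) → ℤ) 1
    have e : (fun i : ZMod (n + 1) => (Pi.single a 1 : ZMod (n + 1) → ℤ) (i - (1 : ℕ))) =
        Pi.single (a + 1) 1 := by
      funext i
      simp [Pi.single_apply, sub_eq_iff_eq_add]
    rw [e, pow_one] at hs
    have := (Int.ModEq.refl (n := 3 ^ (n + 1) - 1)
      (ternaryValue j - 3 * ternaryValue (Pi.single a 1))).add hs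
    simpa using this

/-- Amortized estimate along i ↦ i + (h + 1). With s = j (i - (h+1)) + c (i - 1), the difference c i
- j i is at least -1, with equality only for s = k i = 0 and j i = 2. A potential with values -1 and
0 absorbs this loss: a loss raises it to 0, and only a gain brings it back to -1. -/
theorem sum_digits_le_sum_carries (h : ℕ) (j k c : ZMod (2 * h + 1) → ℤ)
    (hj : ∀ i, 0 ≤ j i ∧ j i ≤ 2) (hk : ∀ i, 0 ≤ k i)
    (hc : ∀ i, 3 * c i = (j (i - (h + 1 : ℕ)) + 2 * j i + k i - 1) + c (i - 1)) :
    ∑ i, j i ≤ ∑ i, c i := by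
  have hc0 : ∀ i, 0 ≤ c i := carries_nonneg
    (fun i => by have := hj i; have := hj (i - (h + 1 : ℕ)); have := hk i; omega) hc
  let P : ℤ → ℤ → ℤ := fun s d => if s ≤ 0 ∨ (s = 1 ∧ d ≤ 2) ∨ (s = 2 ∧ d ≤ 0) then -1 else 0
  let φ : ZMod (2 * h + 1) → ℤ := fun i =>
    P (j (i - (h + 1 : ℕ)) + c (i - 1)) (c (i - (h + 1 : ℕ)))
  have hstep : ∀ i, φ i - φ (i + (h + 1 : ℕ)) ≤ c i - j i := by
    intro i
    -- Since 2(h + 1) = 1 in `ZMod (2 * h + 1)`, the state (s, d) at `i` is followed by (j i + d, c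
    -- i) at i + (h + 1).
    have hz : ((2 * h + 1 : ℕ) : ZMod (2 * h + 1)) = 0 := ZMod.natCast_self _
    have e1 : i + ((h + 1 : ℕ) : ZMod (2 * h + 1)) - 1 = i - (h + 1 : ℕ) := by
      push_cast at hz ⊢
      linear_combination hz
    have e2 : i + ((h + 1 : ℕ) : ZMod (2 * h + 1)) - (h + 1 : ℕ) = i := by ring
    simp only [φ, P, e1, e2]
    have h1 := hc i
    have h2 := hj i
    have h3 := hj (i - (h + 1 : ℕ))
    have h4 := hk i
    have h5 := hc0 i
    have h6 := hc0 (i - 1)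
    have h7 := hc0 (i - (h + 1 : ℕ))
    split_ifs <;> omega
  have hsum := Finset.sum_le_sum fun i (_ : i ∈ Finset.univ) => hstep i
  have hshift : ∑ i, φ (i + (h + 1 : ℕ)) = ∑ i, φ i :=
    Equiv.sum_comp (Equiv.addRight (((h + 1 : ℕ) : ZMod (2 * h + 1)))) φ
  rw [Finset.sum_sub_distrib, Finset.sum_sub_distrib, hshift, sub_self] at hsum
  linarith

/-- If `(3 ^ (h + 1) + 2) j + k` is congruent to the all-ones digit string, then the digit sums
of `j` and `k` add up to at least the number of digits. -/
theorem card_digits_le_sum_digits (h : ℕ) (j k : ZMod (2 * h + 1) → ℤ)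
    (hj : ∀ i, 0 ≤ j i) (hk : ∀ i, 0 ≤ k i)
    (hjk : (3 ^ (h + 1) + 2) * ternaryValue j + ternaryValue k ≡
      ternaryValue (1 : ZMod (2 * h + 1) → ℤ)
      [ZMOD 3 ^ (2 * h + 1) - 1]) :
    (2 * h + 1 : ℤ) ≤ ∑ i, j i + ∑ i, k i := by
  obtain ⟨j', hj', hle, hmod⟩ := exists_reduced_digits j hj
  set s : ZMod (2 * h + 1) → ℤ := fun i => j' (i - (h + 1 : ℕ)) with hs
  have hD : (3 ^ (2 * h + 1) - 1 : ℤ) ∣ ternaryValue (s + (2 : ℤ) • j' + k - 1) := by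
    rw [← Int.modEq_zero_iff_dvd, ternaryValue_sub, ternaryValue_add, ternaryValue_add,
      ternaryValue_smul]
    have h1 : ternaryValue s + 2 * ternaryValue j' + ternaryValue k ≡
        3 ^ (h + 1) * ternaryValue j + 2 * ternaryValue j + ternaryValue k
        [ZMOD 3 ^ (2 * h + 1) - 1] :=
      (((ternaryValue_shift_modEq j' (h + 1)).trans (hmod.mul_left _)).add
        (hmod.mul_left 2)).add_right _
    have h2 := (h1.trans ((add_mul _ _ (ternaryValue j)) ▸ hjk)).sub_right
      (ternaryValue (1 : ZMod (2 * h + 1) → ℤ))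
    rwa [sub_self] at h2
  obtain ⟨c, hc⟩ := exists_cyclic_carries _ hD
  have hc' : ∀ i, 3 * c i = (j' (i - (h + 1 : ℕ)) + 2 * j' i + k i - 1) + c (i - 1) := hc
  have h1 := sum_digits_le_sum_carries h j' k c hj' hk hc'
  -- Summing the carry equations gives 2∑c = 3∑j' + ∑k - (2h + 1); combine with ∑j' ≤ ∑c.
  have h2 := Finset.sum_congr rfl fun i (_ : i ∈ Finset.univ) => hc' i
  simp only [Finset.sum_add_distrib, Finset.sum_sub_distrib, ← Finset.mul_sum] at h2
  have h3 := Equiv.sum_comp (Equiv.subRight (((h + 1 : ℕ) : ZMod (2 * h + 1)))) j'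
  have h4 := Equiv.sum_comp (Equiv.subRight (1 : ZMod (2 * h + 1))) c
  simp only [Equiv.subRight_apply] at h3 h4
  rw [h3, h4] at h2
  simp only [Finset.sum_const, Finset.card_univ, ZMod.card, nsmul_eq_mul, mul_one] at h2
  push_cast at h2
  linarith

/-! ### Weights of exponents. -/

/-- `N` is congruent to a sum of `d` terms of the form `(3 ^ (h + 1) + 2) * 3 ^ i` or `3 ^ i`. -/
def IsWeightedExponent (h : ℕ) (d : ℤ) (N : ℕ) : Prop :=
  ∃ j k : ZMod (2 * h + 1) → ℤ, (∀ i, 0 ≤ j i) ∧ (∀ i, 0 ≤ k i) ∧ ∑ i, j i + ∑ i, k i = d ∧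
    (N : ℤ) ≡ (3 ^ (h + 1) + 2) * ternaryValue j + ternaryValue k [ZMOD 3 ^ (2 * h + 1) - 1]

namespace IsWeightedExponent

variable {h : ℕ}

theorem add {d e : ℤ} {M N : ℕ} (hM : IsWeightedExponent h d M) (hN : IsWeightedExponent h e N) :
    IsWeightedExponent h (d + e) (M + N) := by
  obtain ⟨j, k, hj, hk, hd, hm⟩ := hM
  obtain ⟨j', k', hj', hk', hd', hm'⟩ := hN
  refine ⟨j + j', k + k', fun i => add_nonneg (hj i) (hj' i), fun i => add_nonneg (hk i) (hk' i),
    ?_, ?_⟩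
  · simp only [Pi.add_apply, Finset.sum_add_distrib]
    linarith
  · rw [ternaryValue_add, ternaryValue_add]
    convert hm.add hm' using 1
    · push_cast; rfl
    · ring

/-- Modulo `3 ^ (2 * h + 1) - 1`, multiplication by 3 only rotates the digits. -/
theorem three_mul {d : ℤ} {N : ℕ} (hN : IsWeightedExponent h d N) :
    IsWeightedExponent h d (3 * N) := by
  obtain ⟨j, k, hj, hk, hd, hm⟩ := hN
  have hsum (f : ZMod (2 * h + 1) → ℤ) : ∑ i, f (i - (1 : ℕ)) = ∑ i, f i :=
    Equiv.sum_comp (Equiv.subRight ((1 : ℕ) : ZMod (2 * h + 1))) f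
  refine ⟨fun i => j (i - (1 : ℕ)), fun i => k (i - (1 : ℕ)), fun i => hj _, fun i => hk _,
    by rw [hsum, hsum, hd], ?_⟩
  have h1 := ((ternaryValue_shift_modEq j 1).mul_left (3 ^ (h + 1) + 2)).add
    (ternaryValue_shift_modEq k 1)
  refine Int.ModEq.trans ?_ h1.symm
  convert hm.mul_left 3 using 1
  · push_cast; rfl
  · ring

theorem three_pow_mul {d : ℤ} {N : ℕ} (hN : IsWeightedExponent h d N) (i : ℕ) :
    IsWeightedExponent h d (3 ^ i * N) := by
  induction i with
  | zero => simpa using hN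
  | succ i ih => rw [pow_succ', mul_assoc]; exact ih.three_mul

theorem nonneg_single (i : ZMod (2 * h + 1)) :
    0 ≤ (Pi.single 0 1 : ZMod (2 * h + 1) → ℤ) i := by
  rw [Pi.single_apply]; split_ifs <;> norm_num

theorem one : IsWeightedExponent h 1 1 := by
  refine ⟨0, Pi.single 0 1, fun i => le_rfl, nonneg_single, by simp, ?_⟩
  rw [ternaryValue_single]
  simp [ternaryValue]

theorem base : IsWeightedExponent h 1 (3 ^ (h + 1) + 2) := by
  refine ⟨Pi.single 0 1, 0, nonneg_single, fun i => le_rfl, by simp, ?_⟩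
  rw [ternaryValue_single]
  simp [ternaryValue]

theorem le_of_dvd {r N : ℕ} (hN : IsWeightedExponent h (2 * r + 1) N)
    (hd : 3 ^ (2 * h + 1) - 1 ∣ N + (3 ^ (2 * h + 1) - 1) / 2) : h ≤ r := by
  obtain ⟨j, k, hj, hk, hd', hm⟩ := hN
  have h1 : ((3 ^ (2 * h + 1) - 1 : ℕ) : ℤ) = 3 ^ (2 * h + 1) - 1 := by
    rw [Nat.cast_sub (Nat.one_le_pow _ _ (by norm_num))]; push_cast; rfl
  have h2 := two_mul_ternaryValue_one (n := 2 * h)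
  have h3 : (((3 ^ (2 * h + 1) - 1) / 2 : ℕ) : ℤ) =
      ternaryValue (1 : ZMod (2 * h + 1) → ℤ) := by omega
  have h4 : (3 ^ (2 * h + 1) - 1 : ℤ) ∣ N + ternaryValue (1 : ZMod (2 * h + 1) → ℤ) := by
    rw [← h3, ← h1]; exact_mod_cast hd
  have h5 : (N : ℤ) ≡ ternaryValue (1 : ZMod (2 * h + 1) → ℤ) [ZMOD 3 ^ (2 * h + 1) - 1] := by
    rw [Int.modEq_iff_dvd]
    have : ternaryValue (1 : ZMod (2 * h + 1) → ℤ) - N =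
      (3 ^ (2 * h + 1) - 1) - (N + ternaryValue (1 : ZMod (2 * h + 1) → ℤ)) := by linarith
    rw [this]
    exact dvd_sub dvd_rfl h4
  have := card_digits_le_sum_digits h j k hj hk (hm.symm.trans h5)
  omega

end IsWeightedExponent

/-! ### The trace lifted to the integers. -/

section BalancedTrace

variable {F : Type*} [Field F] [Algebra (ZMod 3) F]

/-- The trace to `ZMod 3`, lifted to `{-1, 0, 1}`. -/
noncomputable def balancedTrace (z : F) : ℤ := (Algebra.trace (ZMod 3) F z).valMinAbs

theorem balancedTrace_pow_three (z : F) (n : ℕ) : balancedTrace z ^ 3 ^ n = balancedTrace z := by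
  have : ∀ a : ZMod 3, a.valMinAbs = 0 ∨ a.valMinAbs = 1 ∨ a.valMinAbs = -1 := by decide
  have hodd : Odd (3 ^ n) := Odd.pow (by decide)
  rcases this (Algebra.trace (ZMod 3) F z) with h | h | h <;> rw [balancedTrace, h]
  · simp
  · simp
  · exact hodd.neg_one_pow

variable [Fintype F]

theorem finrank_eq_of_card_eq_three_pow {h : ℕ} (hF : Fintype.card F = 3 ^ (2 * h + 1)) :
    Module.finrank (ZMod 3) F = 2 * h + 1 := by
  have h1 := Module.card_eq_pow_finrank (K := ZMod 3) (V := F)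
  rw [hF, ZMod.card] at h1
  exact Nat.pow_right_injective (by norm_num : 2 ≤ 3) h1.symm

end BalancedTrace

/-! ### Divisibility by `3 ^ h` through Witt vectors. -/

section Teichmuller

open WittVector

variable {F : Type*} [Field F]

theorem teichmuller_injective : Function.Injective (teichmuller 3 : F → WittVector 3 F) :=
  fun x y hxy => by
    simpa only [teichmuller_coeff_zero] using congrArg (fun z : WittVector 3 F => z.coeff 0) hxy

variable (F) in
/-- Functions spanned by `3 ^ r * x ^ N`, where `N` has weight `2 r + 1` and `x` runs over
Teichmüller representatives. -/
noncomputable def oddSpan (h : ℕ) : Submodule (WittVector 3 F) (F → WittVector 3 F) :=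
  Submodule.span _ {f | ∃ r N : ℕ, IsWeightedExponent h (2 * r + 1) N ∧
    f = fun x => 3 ^ r * teichmuller 3 x ^ N}

variable {h : ℕ}

/-- The extra factor 3 pays for the added weights: (2r+1) + (2s+1) + (2t+1) = 2(r+s+t+1) + 1. -/
theorem three_mul_mul_mul_mem_oddSpan {f g k : F → WittVector 3 F} (hf : f ∈ oddSpan F h)
    (hg : g ∈ oddSpan F h) (hk : k ∈ oddSpan F h) : 3 * (f * g * k) ∈ oddSpan F h := by
  induction hf using Submodule.span_induction with
  | zero => simp
  | add f f' _ _ h1 h2 =>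
    have : 3 * ((f + f') * g * k) = 3 * (f * g * k) + 3 * (f' * g * k) := by ring
    rw [this]; exact add_mem h1 h2
  | smul c f _ h1 =>
    have : 3 * (c • f * g * k) = c • (3 * (f * g * k)) := by
      rw [smul_mul_assoc, smul_mul_assoc, mul_smul_comm]
    rw [this]; exact Submodule.smul_mem _ _ h1
  | mem f hf =>
  obtain ⟨r, N, hN, rfl⟩ := hf
  induction hg using Submodule.span_induction with
  | zero => simp
  | add g g' _ _ h1 h2 => rw [mul_add, add_mul, mul_add]; exact add_mem h1 h2
  | smul c g _ h1 =>
    rw [mul_smul_comm, smul_mul_assoc, mul_smul_comm]; exact Submodule.smul_mem _ _ h1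
  | mem g hg =>
  obtain ⟨s, M, hM, rfl⟩ := hg
  induction hk using Submodule.span_induction with
  | zero => simp
  | add g g' _ _ h1 h2 => rw [mul_add, mul_add]; exact add_mem h1 h2
  | smul c g _ h1 => rw [mul_smul_comm, mul_smul_comm]; exact Submodule.smul_mem _ _ h1
  | mem k hk =>
  obtain ⟨t, L, hL, rfl⟩ := hk
  refine Submodule.subset_span ⟨r + s + t + 1, N + M + L, ?_, ?_⟩
  · convert (hN.add hM).add hL using 1
    push_cast; ring
  · funext x
    simp only [Pi.mul_apply, Pi.ofNat_apply]
    ring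

/-- Mixed terms of a cube carry a factor 3, and a pure cube of a monomial keeps its weight. -/
theorem pow_three_mem_oddSpan {f : F → WittVector 3 F} (hf : f ∈ oddSpan F h) :
    f ^ 3 ∈ oddSpan F h := by
  induction hf using Submodule.span_induction with
  | zero => simp
  | add f g hf hg h1 h2 =>
    have : (f + g) ^ 3 = f ^ 3 + g ^ 3 + 3 * (f * f * g) + 3 * (f * g * g) := by ring
    rw [this]
    exact add_mem (add_mem (add_mem h1 h2) (three_mul_mul_mul_mem_oddSpan hf hf hg))
      (three_mul_mul_mul_mem_oddSpan hf hg hg)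
  | smul c f _ h1 =>
    rw [smul_pow]; exact Submodule.smul_mem _ _ h1
  | mem f hf =>
    obtain ⟨r, N, hN, rfl⟩ := hf
    have : (fun x : F => (3 : WittVector 3 F) ^ r * teichmuller 3 x ^ N) ^ 3 =
        (3 : WittVector 3 F) ^ (2 * r) • fun x => 3 ^ r * teichmuller 3 x ^ (3 * N) := by
      funext x
      simp only [Pi.pow_apply, Pi.smul_apply, smul_eq_mul]
      ring
    rw [this]
    exact Submodule.smul_mem _ _ (Submodule.subset_span ⟨r, 3 * N, hN.three_mul, rfl⟩)

theorem pow_three_pow_mem_oddSpan {f : F → WittVector 3 F} (hf : f ∈ oddSpan F h) (n : ℕ) :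
    f ^ 3 ^ n ∈ oddSpan F h := by
  induction n with
  | zero => simpa using hf
  | succ n ih => rw [pow_succ, pow_mul]; exact pow_three_mem_oddSpan ih

theorem teichmuller_mul_pow_mem_oddSpan {N : ℕ} (hN : IsWeightedExponent h 1 N) (c : F) (i : ℕ) :
    (fun x : F => teichmuller 3 (c * x ^ N) ^ 3 ^ i) ∈ oddSpan F h := by
  have : (fun x : F => teichmuller 3 (c * x ^ N) ^ 3 ^ i) =
      teichmuller 3 c ^ 3 ^ i • fun x => 3 ^ 0 * teichmuller 3 x ^ (3 ^ i * N) := by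
    funext x
    simp only [map_mul, map_pow, Pi.smul_apply, smul_eq_mul]
    ring
  rw [this]
  exact Submodule.smul_mem _ _ (Submodule.subset_span
    ⟨0, 3 ^ i * N, by simpa using hN.three_pow_mul i, rfl⟩)

theorem teichmuller_neg_one [CharP F 3] : teichmuller 3 (-1 : F) = -1 := by
  have h1 : teichmuller 3 (-1 : F) ^ 2 = 1 := by rw [← map_pow]; simp
  refine (sq_eq_one_iff.1 h1).resolve_left fun h => ?_
  rw [← map_one (teichmuller 3 (R := F))] at h
  exact Ring.neg_one_ne_one_of_char_ne_two (by rw [ringChar.eq F 3]; norm_num)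
    (teichmuller_injective h)

variable [Fintype F]

theorem constantCoeff_balancedTrace [Algebra (ZMod 3) F]
    (hF : Fintype.card F = 3 ^ (2 * h + 1)) (z : F) :
    constantCoeff ((balancedTrace z : ℤ) : WittVector 3 F) =
      constantCoeff (∑ i ∈ Finset.range (2 * h + 1), teichmuller 3 z ^ 3 ^ i) := by
  have h1 := FiniteField.algebraMap_trace_eq_sum_pow (ZMod 3) F z
  rw [finrank_eq_of_card_eq_three_pow hF, Nat.card_zmod] at h1
  have h2 : constantCoeff (teichmuller 3 z) = z := teichmuller_coeff_zero 3 z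
  rw [map_intCast, map_sum]
  simp only [map_pow, h2]
  rw [← h1, ← map_intCast (algebraMap (ZMod 3) F), balancedTrace, ZMod.coe_valMinAbs]

variable [CharP F 3]

theorem sum_teichmuller_pow_eq_zero {K : ℕ} (hK : ¬ Fintype.card F - 1 ∣ K) :
    ∑ x : F, teichmuller 3 x ^ K = 0 := by
  have hK' := mt (FiniteField.forall_pow_eq_one_iff F K).1 (by exact hK)
  push Not at hK'
  obtain ⟨a, ha⟩ := hK'
  have h1 : teichmuller 3 (a : F) ^ K ≠ 1 := by
    rw [← map_pow, ← map_one (teichmuller 3 (R := F))]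
    intro e
    exact ha (Units.ext (by simpa using teichmuller_injective e))
  have h2 : ∑ x : F, teichmuller 3 x ^ K =
      teichmuller 3 (a : F) ^ K * ∑ x : F, teichmuller 3 x ^ K := by
    rw [Finset.mul_sum, ← Equiv.sum_comp (Equiv.mulLeft₀ (a : F) a.ne_zero)]
    simp [mul_pow]
  have h3 : (teichmuller 3 (a : F) ^ K - 1) * ∑ x : F, teichmuller 3 x ^ K = 0 := by
    rw [sub_mul, ← h2]; ring
  exact (mul_eq_zero.1 h3).resolve_left (sub_ne_zero.2 h1)

theorem three_dvd_iff_coeff_zero (z : WittVector 3 F) :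
    (3 : WittVector 3 F) ∣ z ↔ constantCoeff z = 0 := by
  have := ker_constantCoeff (k := F) (p := 3)
  rw [← RingHom.mem_ker, this, Ideal.mem_span_singleton]
  rfl

/-- Returns from Witt vectors to the integers; the residue field has characteristic 3. -/
theorem three_pow_dvd_of_dvd_intCast (n : ℕ) (M : ℤ)
    (hM : (3 : WittVector 3 F) ^ n ∣ (M : WittVector 3 F)) : (3 : ℤ) ^ n ∣ M := by
  induction n generalizing M with
  | zero => simp
  | succ n ih =>
    have h1 := (three_dvd_iff_coeff_zero _).1 ((dvd_pow_self _ n.succ_ne_zero).trans hM)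
    rw [map_intCast] at h1
    obtain ⟨M', rfl⟩ := (CharP.intCast_eq_zero_iff F 3 M).1 h1
    have h3 : (3 : WittVector 3 F) ≠ 0 := by exact_mod_cast WittVector.p_nonzero 3 F
    rw [pow_succ'] at hM ⊢
    push_cast at hM ⊢
    exact mul_dvd_mul_left _ (ih M' ((mul_dvd_mul_iff_left h3).1 hM))

variable [DecidableEq F]

theorem intCast_quadraticChar_eq_teichmuller_pow (x : F) :
    ((quadraticChar F x : ℤ) : WittVector 3 F) = teichmuller 3 x ^ (Fintype.card F / 2) := by
  have h2 : ringChar F ≠ 2 := by rw [ringChar.eq F 3]; norm_num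
  rw [← map_pow, ← quadraticChar_eq_pow_of_char_ne_two' h2]
  rcases eq_or_ne x 0 with rfl | hx
  · simp
  · rcases quadraticChar_dichotomy hx with h | h <;> rw [h]
    · simp
    · simp [teichmuller_neg_one]

theorem three_pow_dvd_sum_quadraticChar_mul (hF : Fintype.card F = 3 ^ (2 * h + 1))
    {f : F → WittVector 3 F} (hf : f ∈ oddSpan F h) :
    (3 : WittVector 3 F) ^ h ∣ ∑ x, ((quadraticChar F x : ℤ) : WittVector 3 F) * f x := by
  induction hf using Submodule.span_induction with
  | zero => simp
  | add f g hf hg h1 h2 =>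
    simp only [Pi.add_apply, mul_add, Finset.sum_add_distrib]
    exact dvd_add h1 h2
  | smul c f _ h1 =>
    simp only [Pi.smul_apply, smul_eq_mul, mul_left_comm, ← Finset.mul_sum]
    exact h1.mul_left _
  | mem f hf =>
    obtain ⟨r, N, hN, rfl⟩ := hf
    simp only [intCast_quadraticChar_eq_teichmuller_pow, mul_left_comm _ ((3 : WittVector 3 F) ^ r),
      ← Finset.mul_sum, ← pow_add]
    by_cases hd : Fintype.card F - 1 ∣ Fintype.card F / 2 + N
    · have hodd : (3 ^ (2 * h + 1)) % 2 = 1 := by simp [Nat.pow_mod]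
      have e : 3 ^ (2 * h + 1) / 2 = (3 ^ (2 * h + 1) - 1) / 2 := by omega
      rw [hF, add_comm _ N, e] at hd
      exact (pow_dvd_pow _ (hN.le_of_dvd hd)).mul_right _
    · rw [sum_teichmuller_pow_eq_zero hd, mul_zero]
      exact dvd_zero _

variable [Algebra (ZMod 3) F]

/-- The lifted trace agrees modulo 3 with the sum `t` of Teichmüller conjugates. Taking `3 ^ h`-th
powers improves this to a congruence modulo `3 ^ (h + 1)`, and does not change the lifted trace,
whose values are 0 and ±1. -/
theorem three_pow_dvd_sum_quadraticChar_mul_balancedTrace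
    (hF : Fintype.card F = 3 ^ (2 * h + 1)) (θ e : F) :
    (3 : ℤ) ^ h ∣ ∑ x : F, quadraticChar F x *
      balancedTrace (θ * x ^ (3 ^ (h + 1) + 2) + e * x ^ 1) := by
  apply three_pow_dvd_of_dvd_intCast (F := F)
  set t : F → WittVector 3 F := ∑ i ∈ Finset.range (2 * h + 1),
    ((fun x : F => teichmuller 3 (θ * x ^ (3 ^ (h + 1) + 2)) ^ 3 ^ i) +
      (fun x : F => teichmuller 3 (e * x ^ 1) ^ 3 ^ i)) with ht
  have htmem : t ∈ oddSpan F h := sum_mem fun i _ =>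
    add_mem (teichmuller_mul_pow_mem_oddSpan .base θ i) (teichmuller_mul_pow_mem_oddSpan .one e i)
  have happrox : ∀ x : F, (3 : WittVector 3 F) ^ h ∣
      ((balancedTrace (θ * x ^ (3 ^ (h + 1) + 2) + e * x ^ 1) : ℤ) : WittVector 3 F) -
        (t ^ 3 ^ h) x := by
    intro x
    set n := balancedTrace (θ * x ^ (3 ^ (h + 1) + 2) + e * x ^ 1) with hn
    have h1 : ((3 : ℕ) : WittVector 3 F) ∣ (n : WittVector 3 F) - t x := by
      refine (three_dvd_iff_coeff_zero _).2 ?_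
      rw [map_sub, hn, constantCoeff_balancedTrace hF, sub_eq_zero, ht, Finset.sum_apply, map_sum,
        map_sum]
      refine Finset.sum_congr rfl fun i _ => ?_
      have h2 : ∀ z : F, constantCoeff (teichmuller 3 z) = z := teichmuller_coeff_zero 3
      simp only [Pi.add_apply, map_add, map_pow, h2]
      exact add_pow_char_pow _ _ _ _
    have h2 := dvd_sub_pow_of_dvd_sub h1 h
    rw [← Int.cast_pow, hn, balancedTrace_pow_three] at h2
    exact (pow_dvd_pow _ h.le_succ).trans (by exact_mod_cast h2)
  have hmain := three_pow_dvd_sum_quadraticChar_mul hF (pow_three_pow_mem_oddSpan htmem h)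
  push_cast
  have hdiff := Finset.dvd_sum fun x (_ : x ∈ Finset.univ) =>
    (happrox x).mul_left ((quadraticChar F x : ℤ) : WittVector 3 F)
  have := dvd_add hdiff hmain
  rw [← Finset.sum_add_distrib] at this
  simpa only [mul_sub, sub_add_cancel] using this

end Teichmuller

/-! ### Injectivity of the Ree–Tits polynomial. -/

section ReeTits

variable {F : Type*} [Field F] [CharP F 3]

theorem reeTits_branch_false {σ : F →+* F} (hσ : ∀ x, σ (σ x) = x ^ 3)
    {g r : F} (h1 : σ g = g ^ 2 + r * σ r - r ^ 2 - 1)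
    (hA : (r + 1) * (σ r + g + r) + g ^ 2 = 0) : False := by
  have h3 : (3 : F) = 0 := by exact_mod_cast CharP.cast_eq_zero F 3
  obtain ⟨ρ, rfl⟩ : ∃ ρ, r = ρ - 1 := ⟨r + 1, by ring⟩
  rw [map_sub, map_one] at h1 hA
  set p := σ ρ with hp
  have hρ : ρ ≠ 0 := by
    intro h0
    have hg : g = 0 := by simpa [h0] using hA
    rw [hp, h0, hg] at h1
    simp only [map_zero] at h1
    have : (1 : F) = 0 := by linear_combination h1 - h3 * 0
    exact one_ne_zero this
  have hp0 : p ≠ 0 := by simpa [hp] using hρ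
  obtain ⟨μ, rfl⟩ : ∃ μ, g = ρ * (μ + 1) := ⟨g / ρ - 1, by field_simp; ring⟩
  have hpμ : p = -1 - ρ * μ ^ 2 := by
    apply mul_left_cancel₀ hρ
    linear_combination hA - (ρ ^ 2 * μ + ρ ^ 2 - ρ) * h3
  have hg' : σ (ρ * (μ + 1)) = ρ * μ * (μ - ρ) := by
    rw [h1, hpμ]
    grind
  set ν := ρ * μ with hν
  have hν' : σ ν = 1 - ν * (ρ + μ) := by
    have : ν = ρ * (μ + 1) - ρ := by rw [hν]; ring
    rw [this, map_sub, hg', ← hp, hpμ]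
    grind
  have hp' : ρ ^ 3 * p = -p - (σ ν) ^ 2 := by
    have e : ρ * p = -ρ - ν ^ 2 := by rw [hpμ, hν]; ring
    have := congrArg σ e
    simpa only [map_mul, map_sub, map_neg, map_pow, hp, hσ, mul_comm] using this
  -- Comparing two expressions for σ(ρp) leaves a polynomial identity in ρ and μ alone, which
  -- factors.
  have hfac : ρ ^ 2 * ((ρ - μ) * (1 + μ) ^ 3) = 0 := by
    rw [hν', hpμ, hν] at hp'
    grind
  rcases mul_eq_zero.1 ((mul_eq_zero.1 hfac).resolve_left (pow_ne_zero 2 hρ)) with h | h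
  · obtain rfl : ρ = μ := sub_eq_zero.1 h
    have e : σ ν = p ^ 2 := by rw [hν, map_mul, ← hp, sq]
    have e2 : σ ν = -p := by rw [hν', hpμ, hν]; grind
    have e3 : p = -1 := by
      apply mul_left_cancel₀ hp0
      linear_combination e2 - e
    exact pow_ne_zero 3 hρ (by linear_combination hpμ - e3)
  · have hμ : μ = -1 := by linear_combination pow_eq_zero_iff (n := 3) (by norm_num) |>.1 h
    subst hμ
    have e : ρ * (1 + ρ) = 0 := by
      have : ρ * (-1 + 1) = 0 := by ring
      rw [this, map_zero] at hg'
      linear_combination -hg'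
    have e2 := (mul_eq_zero.1 e).resolve_left hρ
    exact hp0 (by linear_combination hpμ - e2)

/-- Applying σ to the equation and eliminating σ g leaves a product of two factors, exchanged by r ↦
-r. -/
theorem reeTits_ne {σ : F →+* F} (hσ : ∀ x, σ (σ x) = x ^ 3)
    {g r : F} : σ g - g ^ 2 ≠ r * σ r - r ^ 2 - 1 := by
  intro h0
  have h1 : σ g = g ^ 2 + r * σ r - r ^ 2 - 1 := by linear_combination h0
  have h2 := congrArg σ h1
  simp only [map_sub, map_add, map_mul, map_pow, map_one, hσ] at h2
  have hAB : ((r + 1) * (σ r + g + r) + g ^ 2) *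
      ((r - 1) * (σ r - g + r) + g ^ 2) = 0 := by
    rw [h1] at h2
    grind
  rcases mul_eq_zero.1 hAB with h | h
  · exact reeTits_branch_false hσ h1 h
  · refine reeTits_branch_false hσ (r := -r) (g := g) ?_ ?_
    · rw [map_neg]; linear_combination h1
    · rw [map_neg]; linear_combination h

theorem reeTits_injective {σ : F →+* F} (hσ : ∀ x, σ (σ x) = x ^ 3)
    (b : F) :
    Function.Injective fun x => σ x ^ 2 * x ^ 3 + σ b * σ x - b ^ 2 * x := by
  intro x y hxy
  by_contra hne
  obtain ⟨u, v, rfl, rfl⟩ : ∃ u v, x = u + v ∧ y = u - v :=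
    -- Half sum and half difference, as 1/2 = -1 in characteristic 3.
    ⟨-(x + y), y - x, by grind, by grind⟩
  have hv : v ≠ 0 := by rintro rfl; simp at hne
  have hv' : σ v ≠ 0 := by simpa using hv
  simp only [map_add, map_sub] at hxy
  have hE : (σ u ^ 2 + σ v ^ 2) * v ^ 3 - σ u * σ v * u ^ 3 + σ b * σ v - b ^ 2 * v = 0 := by
    grind
  set r := u / v with hr
  set d := b / (v * σ v) with hd
  set w := d - (r * σ r - r ^ 2 - 1) with hw
  -- This is `hE` divided by v³σ(v)².
  have hw' : σ w = d ^ 2 := by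
    simp only [hw, hd, hr, map_sub, map_mul, map_div₀, map_pow, map_one, hσ]
    field_simp
    linear_combination hE
  -- From σ w = d² follows w³ = σ(d)², so g = σ(d)/w is a square root of w.
  have key : ∃ g, g ^ 2 = w ∧ σ g = d := by
    by_cases h0 : d = 0
    · refine ⟨0, ?_, by simp [h0]⟩
      have : w = 0 := (map_eq_zero σ).1 (by rw [hw', h0]; norm_num)
      rw [this]; norm_num
    · have hw0 : w ≠ 0 := by
        rintro h
        rw [h, map_zero] at hw'
        exact h0 (pow_eq_zero_iff (by norm_num) |>.1 hw'.symm)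
      have e := congrArg σ hw'
      rw [hσ, map_pow] at e
      refine ⟨σ d / w, ?_, ?_⟩
      · rw [div_pow, ← e]; field_simp
      · rw [map_div₀, hσ, hw']; field_simp
  obtain ⟨g, hg, hg'⟩ := key
  exact reeTits_ne hσ (g := g) (r := r) (by rw [hg, hg', hw]; ring)

end ReeTits

/-! ### The quadratic character. -/

section QuadraticChar

variable {F : Type*} [Field F] [Fintype F] [DecidableEq F]

theorem quadraticChar_neg {h : ℕ} (hF : Fintype.card F = 3 ^ (2 * h + 1)) (x : F) :
    quadraticChar F (-x) = -quadraticChar F x := by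
  have h1 : quadraticChar F (-1) = -1 := by
    rw [quadraticChar_neg_one_iff_not_isSquare, FiniteField.isSquare_neg_one_iff, hF, pow_succ,
      pow_mul, not_not]
    norm_num [Nat.mul_mod, Nat.pow_mod]
  rw [neg_eq_neg_one_mul, map_mul, h1, neg_one_mul]

theorem sum_quadraticChar_sq :
    ∑ x : F, (quadraticChar F x : ℂ) * quadraticChar F x = Fintype.card F - 1 := by
  have h1 : ∀ x : F, (quadraticChar F x : ℂ) * quadraticChar F x = 1 - if x = 0 then 1 else 0 := by
    intro x
    split_ifs with hx
    · simp [hx]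
    · have := quadraticChar_sq_one hx
      rw [← Int.cast_mul, ← sq, this]; simp
  simp only [h1, Finset.sum_sub_distrib]
  simp

end QuadraticChar

/-! ### The trace character and the integer sums T(γ). -/

section TraceCharacter

variable {F : Type*} [Field F] [Algebra (ZMod 3) F]

theorem balancedTrace_neg (z : F) : balancedTrace (-z) = -balancedTrace z := by
  have : ∀ a : ZMod 3, (-a).valMinAbs = -a.valMinAbs := by decide
  rw [balancedTrace, map_neg, this, balancedTrace]

variable (F) in
/-- The additive character `z ↦ exp (2 π i Tr z / 3)`. -/
noncomputable def traceChar : AddChar F ℂ :=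
  (ZMod.stdAddChar (N := 3)).compAddMonoidHom (Algebra.trace (ZMod 3) F).toAddMonoidHom

theorem exp_pow_val_eq_traceChar (z : F) :
    Complex.exp (2 * (Real.pi : ℂ) * Complex.I / 3) ^ (Algebra.trace (ZMod 3) F z).val =
      traceChar F z := by
  have h := ZMod.stdAddChar_coe (N := 3) ((Algebra.trace (ZMod 3) F z).val : ℤ)
  rw [Int.cast_natCast, ZMod.natCast_zmod_val] at h
  rw [traceChar, AddChar.compAddMonoidHom_apply, LinearMap.toAddMonoidHom_coe, h,
    ← Complex.exp_nat_mul]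
  congr 1
  push_cast
  ring

theorem exp_two_pi_div_three :
    Complex.exp (2 * (Real.pi : ℂ) * Complex.I / 3) = -1 / 2 + Complex.I * (√(3 : ℝ) : ℂ) / 2 := by
  have e : 2 * (Real.pi : ℂ) * Complex.I / 3 = ((Real.pi - Real.pi / 3 : ℝ) : ℂ) * Complex.I := by
    push_cast; ring
  rw [e, Complex.exp_mul_I, ← Complex.ofReal_cos, ← Complex.ofReal_sin, Real.cos_pi_sub,
    Real.sin_pi_sub, Real.cos_pi_div_three, Real.sin_pi_div_three]
  push_cast
  ring

theorem I_mul_sqrt_three_sq : (Complex.I * (√(3 : ℝ) : ℂ)) ^ 2 = -3 := by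
  rw [mul_pow, Complex.I_sq, ← Complex.ofReal_pow, Real.sq_sqrt (by norm_num)]
  norm_num

/-- Quadratic interpolation of t ↦ ξ₃^t at t = -1, 0, 1; it splits real and imaginary parts. -/
theorem traceChar_eq (z : F) :
    traceChar F z = 1 + Complex.I * (√(3 : ℝ) : ℂ) / 2 * (balancedTrace z : ℂ) -
      3 / 2 * (balancedTrace z : ℂ) ^ 2 := by
  have h3 := I_mul_sqrt_three_sq
  have hc : ∀ a : ZMod 3, (a.val = 0 ∧ a.valMinAbs = 0) ∨ (a.val = 1 ∧ a.valMinAbs = 1) ∨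
    (a.val = 2 ∧ a.valMinAbs = -1) := by decide
  rw [← exp_pow_val_eq_traceChar, exp_two_pi_div_three, balancedTrace]
  rcases hc (Algebra.trace (ZMod 3) F z) with ⟨h, h'⟩ | ⟨h, h'⟩ | ⟨h, h'⟩ <;> rw [h, h']
  · simp
  · push_cast; ring
  · push_cast
    linear_combination h3 / 4

theorem balancedTrace_eq_zero_or (z : F) :
    balancedTrace z = 0 ∨ balancedTrace z = 1 ∨ balancedTrace z = -1 := by
  have : ∀ a : ZMod 3, a.valMinAbs = 0 ∨ a.valMinAbs = 1 ∨ a.valMinAbs = -1 := by decide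
  exact this _

theorem ringChar_ne_two : ringChar F ≠ 2 := by
  have : CharP F 3 := charP_of_injective_algebraMap (algebraMap (ZMod 3) F).injective 3
  rw [ringChar.eq F 3]; norm_num

variable [Fintype F]

theorem traceChar_ne_one : traceChar F ≠ 1 := by
  intro h
  obtain ⟨z, hz⟩ := Algebra.trace_surjective (ZMod 3) F 1
  have h1 := DFunLike.congr_fun h z
  rw [traceChar, AddChar.compAddMonoidHom_apply, LinearMap.toAddMonoidHom_coe, hz, AddChar.one_apply,
    ← AddChar.map_zero_eq_one (ZMod.stdAddChar (N := 3))] at h1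
  exact one_ne_zero (ZMod.injective_stdAddChar h1)

theorem sum_balancedTrace_sq : 3 * ∑ z : F, balancedTrace z ^ 2 = 2 * Fintype.card F := by
  classical
  have h1 : ∑ z : F, traceChar F z = 0 :=
    AddChar.sum_eq_zero_of_ne_one traceChar_ne_one
  have h2 : ∑ z : F, balancedTrace z = 0 := by
    have : ∑ z : F, balancedTrace (-z) = ∑ z : F, balancedTrace z :=
      Equiv.sum_comp (Equiv.neg F) balancedTrace
    simp only [balancedTrace_neg, Finset.sum_neg_distrib] at this
    omega
  have h2' : ∑ z : F, (balancedTrace z : ℂ) = 0 := by exact_mod_cast h2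
  simp only [traceChar_eq, Finset.sum_add_distrib, Finset.sum_sub_distrib, ← Finset.mul_sum, h2',
    Finset.sum_const, Finset.card_univ, nsmul_eq_mul, mul_one, mul_zero, add_zero] at h1
  have h4 : (3 : ℂ) * ∑ z : F, (balancedTrace z : ℂ) ^ 2 = 2 * Fintype.card F := by
    linear_combination (-2) * h1
  exact_mod_cast h4

variable [DecidableEq F]

/-- The integer sum measuring the imaginary part of `∑ x, χ(x) ψ(γ f(x))`. -/
noncomputable def charTraceSum (f : F → F) (γ : F) : ℤ :=
  ∑ x, quadraticChar F x * balancedTrace (γ * f x)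

variable {h : ℕ} {f : F → F}

theorem sum_quadraticChar_mul_traceChar (hF : Fintype.card F = 3 ^ (2 * h + 1))
    (hodd : ∀ x, f (-x) = -f x) (γ : F) :
    ∑ x, (quadraticChar F x : ℂ) * traceChar F (γ * f x) =
      Complex.I * (√(3 : ℝ) : ℂ) / 2 * (charTraceSum f γ : ℂ) := by
  have h1 : ∑ x : F, (quadraticChar F x : ℂ) = 0 := by
    exact_mod_cast quadraticChar_sum_zero (F := F) ringChar_ne_two
  have h2 : ∑ x : F, quadraticChar F x * balancedTrace (γ * f x) ^ 2 = 0 := by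
    have := Equiv.sum_comp (Equiv.neg F)
      fun x => quadraticChar F x * balancedTrace (γ * f x) ^ 2
    simp only [Equiv.neg_apply, quadraticChar_neg hF, hodd, mul_neg, balancedTrace_neg, even_two,
      Even.neg_pow, neg_mul, Finset.sum_neg_distrib] at this
    omega
  have h2' : ∑ x : F, (quadraticChar F x : ℂ) * (balancedTrace (γ * f x) : ℂ) ^ 2 = 0 := by
    exact_mod_cast h2
  have h3 : ∀ x, (quadraticChar F x : ℂ) * traceChar F (γ * f x) = quadraticChar F x +
      Complex.I * (√(3 : ℝ) : ℂ) / 2 * ((quadraticChar F x : ℂ) * (balancedTrace (γ * f x) : ℂ)) -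
      3 / 2 * ((quadraticChar F x : ℂ) * (balancedTrace (γ * f x) : ℂ) ^ 2) := by
    intro x
    rw [traceChar_eq]; ring
  simp only [h3, Finset.sum_add_distrib, Finset.sum_sub_distrib, ← Finset.mul_sum, h1, h2',
    charTraceSum]
  push_cast
  ring

theorem charTraceSum_neg (γ : F) : charTraceSum f (-γ) = -charTraceSum f γ := by
  simp [charTraceSum, balancedTrace_neg]

/-- Parseval: S(-γ) is the conjugate of S(γ), and injectivity leaves only the diagonal terms. -/
theorem sum_charTraceSum_sq (hF : Fintype.card F = 3 ^ (2 * h + 1))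
    (hodd : ∀ x, f (-x) = -f x) (hinj : Function.Injective f) :
    3 * ∑ γ : F, charTraceSum f γ ^ 2 = 4 * (Fintype.card F * (Fintype.card F - 1)) := by
  set S : F → ℂ := fun γ => ∑ x, (quadraticChar F x : ℂ) * traceChar F (γ * f x) with hS
  have h1 : ∑ γ, S γ * S (-γ) = Fintype.card F * (Fintype.card F - 1) := by
    have e : ∀ γ, S γ * S (-γ) = ∑ x, ∑ y, (quadraticChar F x : ℂ) * quadraticChar F y *
        traceChar F (γ * (f x - f y)) := by
      intro γ
      rw [hS, Finset.sum_mul_sum]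
      refine Finset.sum_congr rfl fun x _ => Finset.sum_congr rfl fun y _ => ?_
      have : γ * (f x - f y) = γ * f x + -γ * f y := by ring
      rw [this, AddChar.map_add_eq_mul]
      ring
    simp only [e]
    rw [Finset.sum_comm]
    have e2 : ∀ x, ∑ γ, ∑ y, (quadraticChar F x : ℂ) * quadraticChar F y *
        traceChar F (γ * (f x - f y)) =
        Fintype.card F * ((quadraticChar F x : ℂ) * quadraticChar F x) := by
      intro x
      rw [Finset.sum_comm]
      simp only [← Finset.mul_sum, sub_eq_zero, hinj.eq_iff,
        AddChar.sum_mulShift _ (AddChar.IsPrimitive.of_ne_one traceChar_ne_one)]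
      simp
      ring
    simp only [e2, ← Finset.mul_sum, sum_quadraticChar_sq]
  have h2 : ∀ γ, S γ * S (-γ) = 3 / 4 * (charTraceSum f γ : ℂ) ^ 2 := by
    intro γ
    simp only [hS, sum_quadraticChar_mul_traceChar hF hodd, charTraceSum_neg]
    push_cast
    linear_combination (-(charTraceSum f γ : ℂ) ^ 2 / 4) * I_mul_sqrt_three_sq
  simp only [h2, ← Finset.mul_sum] at h1
  have h3 : (3 : ℂ) * ∑ γ : F, (charTraceSum f γ : ℂ) ^ 2 =
      4 * (Fintype.card F * (Fintype.card F - 1)) := by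
    linear_combination 4 * h1
  exact_mod_cast h3

/-- Writing t for the lifted trace of γ f(x), the term χ(x)t - t² is even and invariant under x ↦
-x, so its sum vanishes modulo 4. As γ f permutes F, ∑ t² = 2q/3 = 2·9^h ≡ 2. -/
theorem charTraceSum_mod_four (hF : Fintype.card F = 3 ^ (2 * h + 1))
    (hodd : ∀ x, f (-x) = -f x) (hinj : Function.Injective f) {γ : F} (hγ : γ ≠ 0) :
    charTraceSum f γ % 4 = 2 := by
  have hf0 : f 0 = 0 := by
    have := hodd 0
    rw [neg_zero, eq_neg_iff_add_eq_zero, ← two_mul] at this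
    exact (mul_eq_zero.1 this).resolve_left (Ring.two_ne_zero ringChar_ne_two)
  have hbij : Function.Bijective fun x => γ * f x :=
    Finite.injective_iff_bijective.1 ((mul_right_injective₀ hγ).comp hinj)
  have h1 : ∑ x, balancedTrace (γ * f x) ^ 2 = 2 * 9 ^ h := by
    have e := hbij.sum_comp fun z => balancedTrace z ^ 2
    have e2 := sum_balancedTrace_sq (F := F)
    rw [hF, pow_succ, pow_mul] at e2
    rw [e]
    push_cast at e2
    linarith
  have h2 : ∑ x, ((quadraticChar F x * balancedTrace (γ * f x) - balancedTrace (γ * f x) ^ 2 : ℤ) :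
      ZMod 4) = 0 := by
    refine Finset.sum_ninvolution (fun x => -x) ?_ ?_ (fun _ => Finset.mem_univ _) neg_neg
    · intro x
      simp only [quadraticChar_neg hF, hodd, mul_neg, balancedTrace_neg]
      rcases eq_or_ne x 0 with rfl | hx
      · simp [hf0, balancedTrace]
      · rcases quadraticChar_dichotomy hx with h | h <;>
        rcases balancedTrace_eq_zero_or (γ * f x) with h' | h' | h' <;> rw [h, h'] <;> decide
    · intro x hx hx'
      have : x = 0 := by
        rw [neg_eq_iff_add_eq_zero, ← two_mul] at hx'
        exact (mul_eq_zero.1 hx').resolve_left (Ring.two_ne_zero ringChar_ne_two)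
      subst this
      simp [hf0, balancedTrace] at hx
  rw [← Int.cast_sum, Finset.sum_sub_distrib, h1, ZMod.intCast_zmod_eq_zero_iff_dvd] at h2
  have h3 : (9 : ℤ) ^ h % 4 = 1 := by
    have : (9 : ℤ) ^ h ≡ 1 ^ h [ZMOD 4] := Int.ModEq.pow h (by decide)
    simpa [Int.ModEq] using this
  rw [charTraceSum]
  push_cast at h2
  omega

theorem charTraceSum_eq (hF : Fintype.card F = 3 ^ (2 * h + 1))
    (hodd : ∀ x, f (-x) = -f x) (hinj : Function.Injective f)
    (hdvd : ∀ γ, (3 : ℤ) ^ h ∣ charTraceSum f γ) {γ : F} (hγ : γ ≠ 0) :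
    charTraceSum f γ = 2 * 3 ^ h ∨ charTraceSum f γ = -(2 * 3 ^ h) := by
  have hge : ∀ γ : F, (if γ = 0 then 0 else (2 * 3 ^ h) ^ 2 : ℤ) ≤ charTraceSum f γ ^ 2 := by
    intro γ
    split_ifs with hγ
    · positivity
    · have h4 := charTraceSum_mod_four hF hodd hinj hγ
      have h2 : (2 : ℤ) ∣ charTraceSum f γ := by omega
      have hcop : IsCoprime (2 : ℤ) (3 ^ h) := IsCoprime.pow_right ⟨-1, 1, by norm_num⟩
      have h6 := hcop.mul_dvd h2 (hdvd γ)
      rw [sq_le_sq]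
      exact Int.le_of_dvd (abs_pos.2 (by omega)) ((abs_dvd_abs _ _).2 h6)
  have hsum : ∑ γ : F, (if γ = 0 then 0 else (2 * 3 ^ h) ^ 2 : ℤ) = ∑ γ, charTraceSum f γ ^ 2 := by
    have h1 := sum_charTraceSum_sq hF hodd hinj
    have h2 : ∀ γ : F, (if γ = 0 then 0 else (2 * 3 ^ h) ^ 2 : ℤ) =
        (2 * 3 ^ h) ^ 2 - if γ = 0 then (2 * 3 ^ h) ^ 2 else 0 := by
      intro γ; split_ifs <;> simp
    simp only [h2, Finset.sum_sub_distrib, Finset.sum_ite_eq', Finset.mem_univ, if_true,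
      Finset.sum_const, Finset.card_univ, nsmul_eq_mul]
    rw [hF] at h1 ⊢
    push_cast at h1 ⊢
    have h5 : (3 : ℤ) ^ (2 * h + 1) = 3 * (3 ^ h) ^ 2 := by ring
    rw [h5] at h1 ⊢
    linarith
  -- Termwise lower bounds with equal totals must be equalities.
  have := (Finset.sum_eq_sum_iff_of_le fun γ _ => hge γ).1 hsum γ (Finset.mem_univ _)
  rw [if_neg hγ] at this
  exact sq_eq_sq_iff_eq_or_eq_neg.1 this.symm

end TraceCharacter

/-! ### Evaluation of the character sum. -/

section ReeTitsSum

variable {F : Type*} [Field F] [Fintype F] [Algebra (ZMod 3) F]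

theorem trace_pow_three_pow (z : F) (n : ℕ) :
    Algebra.trace (ZMod 3) F (z ^ 3 ^ n) = Algebra.trace (ZMod 3) F z := by
  induction n with
  | zero => simp
  | succ n ih =>
    rw [pow_succ, pow_mul, ← ih,
      ← Algebra.trace_eq_of_algEquiv (FiniteField.frobeniusAlgEquivOfAlgebraic (ZMod 3) F)
        (z ^ 3 ^ n)]
    simp

theorem balancedTrace_mul_reeTits {h : ℕ} (hF : Fintype.card F = 3 ^ (2 * h + 1)) (b γ x : F) :
    balancedTrace (γ * ((x ^ 3 ^ (h + 1)) ^ 2 * x ^ 3 + b ^ 3 ^ (h + 1) * x ^ 3 ^ (h + 1) -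
        b ^ 2 * x)) =
      balancedTrace (γ ^ 3 ^ h * x ^ (3 ^ (h + 1) + 2) + (γ ^ 3 ^ h * b - γ * b ^ 2) * x ^ 1) := by
  have hq : ∀ z : F, z ^ (3 ^ h * 3 ^ (h + 1)) = z := by
    intro z
    rw [← pow_add, show h + (h + 1) = 2 * h + 1 by ring, ← hF, FiniteField.pow_card]
  have hσ : ∀ z : F, z ^ (3 ^ (h + 1) * 3 ^ (h + 1)) = z ^ 3 := by
    intro z
    rw [show 3 ^ (h + 1) * 3 ^ (h + 1) = 3 * (3 ^ h * 3 ^ (h + 1)) by ring, pow_mul, hq]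
  -- The `3 ^ (h + 1)`-th power undoes the `3 ^ h`-th power and preserves the trace.
  have e : (γ ^ 3 ^ h * x ^ (3 ^ (h + 1) + 2) + γ ^ 3 ^ h * b * x) ^ 3 ^ (h + 1) =
      γ * ((x ^ 3 ^ (h + 1)) ^ 2 * x ^ 3 + b ^ 3 ^ (h + 1) * x ^ 3 ^ (h + 1)) := by
    have : CharP F 3 := charP_of_injective_algebraMap (algebraMap (ZMod 3) F).injective 3
    rw [add_pow_char_pow, mul_pow, mul_pow, mul_pow, ← pow_mul γ, hq, ← pow_mul x, add_mul, pow_add,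
      hσ]
    ring
  have e1 : γ * ((x ^ 3 ^ (h + 1)) ^ 2 * x ^ 3 + b ^ 3 ^ (h + 1) * x ^ 3 ^ (h + 1) - b ^ 2 * x) =
      γ * ((x ^ 3 ^ (h + 1)) ^ 2 * x ^ 3 + b ^ 3 ^ (h + 1) * x ^ 3 ^ (h + 1)) - γ * b ^ 2 * x := by
    ring
  have e2 : γ ^ 3 ^ h * x ^ (3 ^ (h + 1) + 2) + (γ ^ 3 ^ h * b - γ * b ^ 2) * x ^ 1 =
      (γ ^ 3 ^ h * x ^ (3 ^ (h + 1) + 2) + γ ^ 3 ^ h * b * x) - γ * b ^ 2 * x := by ring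
  rw [balancedTrace, balancedTrace, e1, e2, map_sub, map_sub, ← e, trace_pow_three_pow]

variable [DecidableEq F] {h : ℕ}

theorem sum_quadraticChar_mul_traceChar_eq (hF : Fintype.card F = 3 ^ (2 * h + 1)) (b : F) :
    (∑ x : F, (quadraticChar F x : ℂ) * traceChar F (x ^ (3 ^ (h + 1) + 2) + (b - b ^ 2) * x) =
      Complex.I * (√((3 ^ (2 * h + 1) : ℕ) : ℝ) : ℂ)) ∨
    (∑ x : F, (quadraticChar F x : ℂ) * traceChar F (x ^ (3 ^ (h + 1) + 2) + (b - b ^ 2) * x) =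
      -(Complex.I * (√((3 ^ (2 * h + 1) : ℕ) : ℝ) : ℂ))) := by
  have hchar : CharP F 3 := charP_of_injective_algebraMap (algebraMap (ZMod 3) F).injective 3
  set f : F → F := fun x => (x ^ 3 ^ (h + 1)) ^ 2 * x ^ 3 + b ^ 3 ^ (h + 1) * x ^ 3 ^ (h + 1) -
    b ^ 2 * x with hf
  have hσ : ∀ z : F, iterateFrobenius F 3 (h + 1) (iterateFrobenius F 3 (h + 1) z) = z ^ 3 := by
    intro z
    rw [← iterateFrobenius_add_apply, iterateFrobenius_def,
      show h + 1 + (h + 1) = (2 * h + 1) + 1 by ring, pow_succ, pow_mul, ← hF,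
      FiniteField.pow_card]
  have hinj : Function.Injective f := reeTits_injective hσ b
  have hodd : ∀ x, f (-x) = -f x := by
    intro x
    have h3 : Odd (3 ^ (h + 1)) := Odd.pow (by decide)
    simp only [hf, h3.neg_pow, (show Odd 3 by decide).neg_pow]
    ring
  have hdvd : ∀ γ, (3 : ℤ) ^ h ∣ charTraceSum f γ := by
    intro γ
    simp only [charTraceSum, hf, balancedTrace_mul_reeTits hF]
    exact three_pow_dvd_sum_quadraticChar_mul_balancedTrace hF _ _
  have hS := sum_quadraticChar_mul_traceChar hF hodd 1
  have htr : ∀ x, traceChar F (x ^ (3 ^ (h + 1) + 2) + (b - b ^ 2) * x) =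
      traceChar F (1 * f x) := by
    intro x
    rw [traceChar_eq, traceChar_eq, hf, balancedTrace_mul_reeTits hF]
    simp
  have hsqrt : (√((3 ^ (2 * h + 1) : ℕ) : ℝ) : ℂ) = √(3 : ℝ) * 3 ^ h := by
    have : √((3 ^ (2 * h + 1) : ℕ) : ℝ) = √(3 : ℝ) * 3 ^ h := by
      push_cast
      rw [pow_succ, mul_comm, Real.sqrt_mul (by norm_num), mul_comm 2, pow_mul,
        Real.sqrt_sq (by positivity)]
    rw [this]
    push_cast
    rfl
  simp only [htr, hS, hsqrt]
  rcases charTraceSum_eq hF hodd hinj hdvd one_ne_zero with h1 | h1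
  · left
    rw [h1]; push_cast; ring
  · right
    rw [h1]; push_cast; ring

end ReeTitsSum

theorem corollary3p4 {F : Type*} [Field F] [Fintype F] [DecidableEq F] [Algebra (ZMod 3) F]
    (h q α : ℕ) (hq : q = 3 ^ (2 * h + 1)) (hα : α = 3 ^ (h + 1))
    (hF : Fintype.card F = q) (a β : F) (ha : a ≠ 0) (hβ : β ≠ 0) :
    (∑ x : Fˣ, (quadraticChar F (x : F) : ℂ) *
        Complex.exp (2 * (Real.pi : ℂ) * Complex.I / 3) ^
          (Algebra.trace (ZMod 3) F
            ((x : F) ^ (α + 2) +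
              (β ^ (α - 1) * a ^ α - β ^ (2 * (α - 1)) * a ^ (2 * α)) * (x : F))).val
      = Complex.I * (√(q : ℝ) : ℂ)) ∨
    (∑ x : Fˣ, (quadraticChar F (x : F) : ℂ) *
        Complex.exp (2 * (Real.pi : ℂ) * Complex.I / 3) ^
          (Algebra.trace (ZMod 3) F
            ((x : F) ^ (α + 2) +
              (β ^ (α - 1) * a ^ α - β ^ (2 * (α - 1)) * a ^ (2 * α)) * (x : F))).val
      = -(Complex.I * (√(q : ℝ) : ℂ))) := by
  subst hq hα
  have hunits : ∀ g : F → ℂ, ∑ x : Fˣ, (quadraticChar F (x : F) : ℂ) * g x =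
      ∑ x : F, (quadraticChar F x : ℂ) * g x := by
    intro g
    refine Finset.sum_of_injOn Units.val Units.val_injective.injOn (by simp) ?_ fun _ _ => rfl
    intro x _ hx
    have : x = 0 := by
      by_contra hne
      exact hx ⟨Units.mk0 x hne, by simp, rfl⟩
    simp [this]
  have hb : β ^ (2 * (3 ^ (h + 1) - 1)) * a ^ (2 * 3 ^ (h + 1)) =
      (β ^ (3 ^ (h + 1) - 1) * a ^ 3 ^ (h + 1)) ^ 2 := by ring
  simp only [exp_pow_val_eq_traceChar, hb]
  rw [hunits fun x => traceChar F (x ^ (3 ^ (h + 1) + 2) + (β ^ (3 ^ (h + 1) - 1) *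
    a ^ 3 ^ (h + 1) - (β ^ (3 ^ (h + 1) - 1) * a ^ 3 ^ (h + 1)) ^ 2) * x)]
  exact sum_quadraticChar_mul_traceChar_eq hF _
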